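/- Let $G=(V,E)$ be a finite graph, possibly with loops and multiple edges, with nonnegative real edge weights $\boldsymbol\lambda=(\lambda_e)_{e\in E}$. For $H\subseteq E$ and $v\in V$ let $\deg(H,v)$ be the degree of $v$ in the spanning subgraph $(V,H)$ (a loop counts twice), and put $\deg(G,v)=\deg(E,v)$. For activities $u_0,u_1,u_2,\dots\in\mathbb C$ (the same at every vertex) let $$Z(\mathbf x)=Z(G,\boldsymbol\lambda,\mathbf u;\mathbf x)=\sum_{H\subseteq E}\Big(\prod_{e\in H}\lambda_e\Big)\prod_{v\in V}u_{\deg(H,v)}\,x_v^{\deg(H,v)},$$ let $Z(y)=Z(G,\boldsymbol\lambda,\mathbf u;y^{1/2}\mathbf 1)$, that is $$Z(y)=\sum_{H\subseteq E}\Big(\prod_{e\in H}\lambda_e\Big)\Big(\prod_{v\in V}u_{\deg(H,v)}\Big)y^{\#H},$$ be the univariate polynomial obtained by setting all $x_v$ equal to $y^{1/2}$, and for $v\in V$ let $K_v(z)=\sum_{j=0}^{d}\binom dj u_jz^j$ with $d=\deg(G,v)$ be the key polynomial at $v$. For $0<\theta\le\pi$ let $S[\theta]=\{z\in\mathbb C: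 z\ne0,\ |\arg z|<\theta\}$, where $-\pi<\arg z\le\pi$. A complex polynomial $F$ in one or several variables is called $A$-nonvanishing, for $A\subseteq\mathbb C$, if either $F$ is identically zero or $F\neq0$ whenever all its variables take values in $A$. Let $u\in\mathbb R$ and take the activities $u_0=u_2=1$, $u_1=u$, and $u_k=0$ for $k>2$. (i) If $u=1$, then every key polynomial $K_v(z)$ is $S[3\pi/4]$-nonvanishing, $Z(\mathbf x)$ is $S[\pi/4]$-nonvanishing, and $Z(y)$ is $S[\pi/2]$-nonvanishing. (ii) Let $\Delta$ be the maximum degree of $G$, and suppose $u\ge\sqrt{2-2/\Delta}$ (no condition on $u$ if $\Delta=0$, i.e. if $G$ has no edges). Then every key polynomial $K_v(z)$ is $S[\pi]$-nonvanishing, $Z(\mathbf x)$ is $S[\pi/2]$-nonvanishing, and $Z(y)$ is $S[\pi]$-nonvanishing; moreover every zero of $Z(y)$ is real and nonpositive. -/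

import Mathlib

open scoped Graph

noncomputable section

namespace SubgraphPoly

variable {α β : Type*}

open Classical in
/-- The degree of the vertex `v` in the spanning subgraph of the multigraph `G` with edge set `H`:
the number of edges of `H` incident with `v`, loops being counted twice. -/
def degree (G : Graph α β) (H : Finset E(G)) (v : V(G)) : ℕ :=
  (H.filter fun e : E(G) => G.Inc e v).card + (H.filter fun e : E(G) => G.IsLoopAt e v).card

/-- The maximum degree of a vertex of the finite multigraph `G` (`0` if there is no vertex). -/
def maxDegree (G : Graph α β) [Fintype V(G)] [Fintype E(G)] : ℕ :=
  Finset.univ.sup fun v : V(G) => degree G Finset.univ v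

/-- The weight `λ^H u_{deg H}` of the spanning subgraph with edge set `H`; the activity of `v`
at degree `k` is `u v k`. -/
def weight (G : Graph α β) [Fintype V(G)] (lam : E(G) → ℂ) (u : V(G) → ℕ → ℂ)
    (H : Finset E(G)) : ℂ :=
  (∏ e ∈ H, lam e) * ∏ v, u v (degree G H v)

/-- `Z(G, λ, u; x) = ∑_{H ⊆ E} λ^H u_{deg H} x^{deg H}`. -/
def Z (G : Graph α β) [Fintype V(G)] [Fintype E(G)] (lam : E(G) → ℂ) (u : V(G) → ℕ → ℂ) :
    MvPolynomial V(G) ℂ :=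
  ∑ H : Finset E(G),
    MvPolynomial.C (weight G lam u H) * ∏ v, MvPolynomial.X v ^ degree G H v

/-- The univariate polynomial `Z(G, λ, u; y^{1/2} 𝟏) = ∑_{H ⊆ E} λ^H u_{deg H} y^{#H}` in the
variable `y`. That it is obtained by this substitution is `expand_two_Zuni`. -/
def Zuni (G : Graph α β) [Fintype V(G)] [Fintype E(G)] (lam : E(G) → ℂ) (u : V(G) → ℕ → ℂ) :
    Polynomial ℂ :=
  ∑ H : Finset E(G), Polynomial.C (weight G lam u H) * Polynomial.X ^ H.card

/-- The key polynomial `K_v(z) = ∑_{j=0}^d (d choose j) u_j^{(v)} z^j` with `d = deg(G, v)`. -/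
def key (G : Graph α β) [Fintype E(G)] (u : V(G) → ℕ → ℂ) (v : V(G)) : Polynomial ℂ :=
  ∑ j ∈ Finset.range (degree G Finset.univ v + 1),
    Polynomial.C (((degree G Finset.univ v).choose j : ℂ) * u v j) * Polynomial.X ^ j

/-- The handshake lemma. -/
theorem sum_degree (G : Graph α β) [Fintype V(G)] (H : Finset E(G)) :
    ∑ v, degree G H v = 2 * H.card := by
  classical
  have h : ∀ e : E(G), (∑ v : V(G), ((if G.Inc e v then 1 else 0) +
      (if G.IsLoopAt e v then 1 else 0))) = 2 := by
    rintro ⟨e, he⟩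
    obtain ⟨x, y, hxy⟩ := (G.edge_mem_iff_exists_isLink e).1 he
    have hInc : ∀ v : V(G), G.Inc e v ↔ v = ⟨x, hxy.left_mem⟩ ∨ v = ⟨y, hxy.right_mem⟩ := by
      intro v
      rw [Subtype.ext_iff, Subtype.ext_iff]
      constructor
      · rintro ⟨w, hw⟩
        exact hw.left_eq_or_eq hxy
      · rintro (h | h)
        · rw [h]; exact hxy.inc_left
        · rw [h]; exact hxy.inc_right
    have hLoop : ∀ v : V(G), G.IsLoopAt e v ↔
        v = ⟨x, hxy.left_mem⟩ ∧ v = ⟨y, hxy.right_mem⟩ := by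
      intro v
      rw [Subtype.ext_iff, Subtype.ext_iff]
      constructor
      · intro h
        have h' : G.IsLink e v v := h
        exact ⟨(hxy.left_eq_or_eq h').elim Eq.symm Eq.symm,
          (hxy.symm.left_eq_or_eq h').elim Eq.symm Eq.symm⟩
      · rintro ⟨h1, h2⟩
        change G.IsLink e v v
        have h3 : G.IsLink e v y := by rw [h1]; exact hxy
        have h4 : (v : α) = y := h2
        rw [← h4] at h3
        exact h3
    have key : ∀ v : V(G), ((if G.Inc e v then 1 else 0) + (if G.IsLoopAt e v then 1 else 0)) =
        (if v = ⟨x, hxy.left_mem⟩ then 1 else 0) + (if v = ⟨y, hxy.right_mem⟩ then 1 else 0) := by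
      intro v
      simp only [hInc v, hLoop v]
      by_cases h1 : v = ⟨x, hxy.left_mem⟩ <;> by_cases h2 : v = ⟨y, hxy.right_mem⟩ <;>
        simp [h1, h2]
      all_goals simp_all
    rw [Finset.sum_congr rfl fun v _ => key v, Finset.sum_add_distrib]
    simp
  simp only [degree, Finset.card_filter, ← Finset.sum_add_distrib]
  rw [Finset.sum_comm, Finset.sum_congr rfl fun e _ => h e]
  simp [mul_comm]

/-- Substituting `y = x ^ 2` in `Zuni` gives the value of `Z` at `x 𝟏 = (x, …, x)`. -/
theorem expand_two_Zuni (G : Graph α β) [Fintype V(G)] [Fintype E(G)] (lam : E(G) → ℂ)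
    (u : V(G) → ℕ → ℂ) :
    Polynomial.expand ℂ 2 (Zuni G lam u) =
      MvPolynomial.aeval (fun _ => (Polynomial.X : Polynomial ℂ)) (Z G lam u) := by
  simp only [Zuni, Z, map_sum, map_mul, map_prod, map_pow, Polynomial.expand_C,
    Polynomial.expand_X, MvPolynomial.aeval_X, MvPolynomial.aeval_C, Finset.prod_pow_eq_pow_sum,
    sum_degree, ← pow_mul]
  rfl

/-- The open sector `S[θ]`. -/
def sector (θ : ℝ) : Set ℂ := {z | z ≠ 0 ∧ |z.arg| < θ}

/-- A multivariate polynomial `F` is `A`-nonvanishing if `F ≡ 0` or `F` has no zero all of whose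
coordinates lie in `A`. -/
def Nonvanishing {σ : Type*} (A : Set ℂ) (F : MvPolynomial σ ℂ) : Prop :=
  F = 0 ∨ ∀ z : σ → ℂ, (∀ v, z v ∈ A) → MvPolynomial.eval z F ≠ 0

/-- The same notion for a polynomial in one variable. -/
def Nonvanishing₁ (A : Set ℂ) (P : Polynomial ℂ) : Prop :=
  P = 0 ∨ ∀ z ∈ A, P.eval z ≠ 0

/-- The activities `u_0 = u_2 = 1`, `u_1 = u` and `u_k = 0` for `k > 2`. -/
def ruelleActivity (u : ℝ) (k : ℕ) : ℂ :=
  if k = 0 ∨ k = 2 then 1 else if k = 1 then (u : ℂ) else 0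

end SubgraphPoly

end


/-!
When all activities are `1`, the sum over `H` factorises as `∏ e, (1 + λ_e t_a t_b)` with `a`, `b`
the ends of `e`, which has no zero with all `t_v` in the open right half-plane. As a polynomial in
one variable `t_v` of degree at most `d = deg(G, v)`, it stays nonzero when `t_v ^ j` is replaced by
`u_j x_v ^ j`, provided that `K_v(x_v w) ≠ 0` for all `w` in the closed right half-plane: this is
the Schur–Szegő composition theorem. The proviso holds for `x_v ∈ S[θ]` when `K_v` is
`S[θ + π/2]`-nonvanishing, and the vertices can be treated one after the other.

For the activities `1, u, 1`, the key polynomial is `1 + d u z + (d choose 2) z ^ 2`; it is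
`S[θ + π/2]`-nonvanishing as soon as `√(2 - 2 / d) sin θ ≤ u`.
-/

namespace SubgraphPoly

open Polynomial

/-- The binomial polynomial `∑_{j ≤ d} (d choose j) a_j z^j` of a sequence `a`. It is the key
polynomial of a vertex of degree `d` with activities `a`. -/
noncomputable def binomialPolynomial {R : Type*} [Semiring R] (d : ℕ) (a : ℕ → R) : R[X] :=
  ∑ j ∈ Finset.range (d + 1), C ((d.choose j : R) * a j) * X ^ j

/-- The linear functional `X ^ j ↦ a j` on polynomials. Applied to a polynomial in the variable of
one vertex, it replaces the powers of that variable by activities. -/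
noncomputable def umbralEval {R : Type*} [CommSemiring R] (a : ℕ → R) : R[X] →ₗ[R] R :=
  lsum fun j => LinearMap.toSpanSingleton R R (a j)

/-- The open right half-plane together with the origin: the range of a vertex variable before it is
replaced by activities. The origin is included to exclude the root `0`, so that every linear factor
can be written as `1 + γ X`. -/
def pointedHalfPlane : Set ℂ := insert 0 {z | 0 < z.re}

section BinomialPolynomial

variable {R : Type*}

theorem coeff_binomialPolynomial [Semiring R] (d : ℕ) (a : ℕ → R) (j : ℕ) :
    (binomialPolynomial d a).coeff j = d.choose j * a j := by
  simp only [binomialPolynomial, finsetSum_coeff, coeff_C_mul_X_pow, Finset.sum_ite_eq,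
    Finset.mem_range]
  split_ifs with hj
  · rfl
  · rw [Nat.choose_eq_zero_of_lt (by omega), Nat.cast_zero, zero_mul]

theorem natDegree_binomialPolynomial_le [Semiring R] (d : ℕ) (a : ℕ → R) :
    (binomialPolynomial d a).natDegree ≤ d :=
  natDegree_le_iff_coeff_eq_zero.2 fun j hj => by
    rw [coeff_binomialPolynomial, Nat.choose_eq_zero_of_lt hj, Nat.cast_zero, zero_mul]

theorem eval_zero_binomialPolynomial [Semiring R] (d : ℕ) (a : ℕ → R) :
    (binomialPolynomial d a).eval 0 = a 0 := by
  rw [← coeff_zero_eq_eval_zero, coeff_binomialPolynomial, Nat.choose_zero_right, Nat.cast_one,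
    one_mul]

theorem eval_binomialPolynomial_mul_pow [CommSemiring R] (d : ℕ) (a : ℕ → R) (x z : R) :
    (binomialPolynomial d fun j => a j * x ^ j).eval z = (binomialPolynomial d a).eval (x * z) := by
  simp only [binomialPolynomial, eval_finsetSum, eval_mul, eval_C, eval_pow, eval_X, mul_pow,
    mul_assoc]

theorem binomialPolynomial_succ [CommSemiring R] (d : ℕ) (a : ℕ → R) :
    binomialPolynomial (d + 1) a =
      binomialPolynomial d a + X * binomialPolynomial d fun j => a (j + 1) := by
  ext (_ | j)
  · simp [coeff_binomialPolynomial]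
  · simp only [coeff_add, coeff_X_mul, coeff_binomialPolynomial, Nat.choose_succ_succ, Nat.cast_add]
    ring

theorem derivative_binomialPolynomial_succ [CommSemiring R] (d : ℕ) (a : ℕ → R) :
    derivative (binomialPolynomial (d + 1) a) =
      C (d + 1 : R) * binomialPolynomial d fun j => a (j + 1) := by
  ext j
  have hchoose : ((d + 1 : R) * d.choose j) = (d + 1).choose (j + 1) * (j + 1) := by
    exact_mod_cast congrArg (Nat.cast : ℕ → R) (Nat.add_one_mul_choose_eq d j)
  rw [coeff_derivative, coeff_C_mul, coeff_binomialPolynomial, coeff_binomialPolynomial,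
    ← mul_assoc, hchoose]
  ring

/-- The right-hand side is the polar derivative of the binomial polynomial with pole `γ`. -/
theorem eval_binomialPolynomial_add_mul_shift [CommRing R] (d : ℕ) (a : ℕ → R) (γ z : R) :
    (d + 1) * (binomialPolynomial d fun j => a j + γ * a (j + 1)).eval z =
      (d + 1) * (binomialPolynomial (d + 1) a).eval z +
        (γ - z) * (derivative (binomialPolynomial (d + 1) a)).eval z := by
  have hlinear : (binomialPolynomial d fun j => a j + γ * a (j + 1)) =
      binomialPolynomial d a + C γ * binomialPolynomial d fun j => a (j + 1) := by
    ext j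
    simp only [coeff_add, coeff_C_mul, coeff_binomialPolynomial]
    ring
  rw [hlinear, derivative_binomialPolynomial_succ, binomialPolynomial_succ]
  simp only [eval_add, eval_mul, eval_C, eval_X]
  ring

theorem umbralEval_C_mul_X_pow [CommSemiring R] (a : ℕ → R) (c : R) (n : ℕ) :
    umbralEval a (C c * X ^ n) = c * a n := by
  simp [umbralEval, lsum_apply, C_mul_X_pow_eq_monomial, sum_monomial_index]

theorem umbralEval_one_add_C_mul_X_mul [CommSemiring R] (a : ℕ → R) (γ : R) (f : R[X]) :
    umbralEval a ((1 + C γ * X) * f) = umbralEval (fun j => a j + γ * a (j + 1)) f := by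
  induction f using Polynomial.induction_on' with
  | add p q hp hq => rw [mul_add, map_add, map_add, hp, hq]
  | monomial n c =>
    have hexpand : (1 + C γ * X) * (C c * X ^ n) = C c * X ^ n + C (γ * c) * X ^ (n + 1) := by
      rw [C_mul]
      ring
    rw [← C_mul_X_pow_eq_monomial, hexpand, map_add]
    simp only [umbralEval_C_mul_X_pow]
    ring

theorem umbralEval_pow [CommSemiring R] (x : R) (f : R[X]) :
    umbralEval (fun j => x ^ j) f = f.eval x := by
  rw [eval_eq_sum]
  rfl

end BinomialPolynomial

/-- The condition `a * ‖w‖ ^ 2 < Re w` describes an open disc, or a half-plane if `a = 0`, with the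
origin on its boundary; a point `p` outside is separated from it by the real linear functional
`w ↦ Re ((1 - 2 * a * conj p) * w)`. -/
theorem neg_mul_normSq_lt_re {a : ℝ} (ha : 0 ≤ a) (p : ℂ) {w : ℂ}
    (hw : a * Complex.normSq w < w.re) :
    -(a * Complex.normSq p) < ((1 - 2 * a * star p) * w).re := by
  have hexpand : ((1 - 2 * a * star p) * w).re =
      w.re - a * Complex.normSq w + a * Complex.normSq (w - p) - a * Complex.normSq p := by
    simp only [Complex.star_def, Complex.mul_re, Complex.mul_im, Complex.sub_re, Complex.sub_im,
      Complex.one_re, Complex.one_im, Complex.re_ofNat, Complex.im_ofNat, Complex.ofReal_re,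
      Complex.ofReal_im, Complex.conj_re, Complex.conj_im, Complex.normSq_apply]
    ring
  have := mul_nonneg ha (Complex.normSq_nonneg (w - p))
  linarith

theorem multiset_sum_ne_natCast_mul_of_mul_normSq_lt_re {a : ℝ} (ha : 0 ≤ a)
    {m : Multiset ℂ} (hm : m ≠ 0) (hdisc : ∀ w ∈ m, a * Complex.normSq w < w.re)
    {d : ℕ} (hd : m.card ≤ d) {p : ℂ} (hp : p.re ≤ a * Complex.normSq p) : m.sum ≠ d * p := by
  intro hsum
  set c := 1 - 2 * a * star p
  have hre : (c * m.sum).re = (m.map fun w => (c * w).re).sum := by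
    have := map_multiset_sum Complex.reAddGroupHom (m.map fun w => c * w)
    rwa [Multiset.sum_map_mul_left, Multiset.map_id', Multiset.map_map] at this
  have hlower : -(m.card * (a * Complex.normSq p)) < (c * m.sum).re := by
    rw [hre]
    have := Multiset.sum_lt_sum_of_nonempty hm fun w hw => neg_mul_normSq_lt_re ha p (hdisc w hw)
    rwa [Multiset.map_const', Multiset.sum_replicate, nsmul_eq_mul, mul_neg] at this
  have hupper : (c * m.sum).re = d * (p.re - 2 * (a * Complex.normSq p)) := by
    rw [hsum]
    simp only [c, Complex.star_def, Complex.mul_re, Complex.mul_im, Complex.sub_re, Complex.sub_im,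
      Complex.one_re, Complex.one_im, Complex.re_ofNat, Complex.im_ofNat, Complex.ofReal_re,
      Complex.ofReal_im, Complex.conj_re, Complex.conj_im, Complex.natCast_re, Complex.natCast_im,
      Complex.normSq_apply]
    ring
  have hcard : (m.card : ℝ) * (a * Complex.normSq p) ≤ d * (a * Complex.normSq p) := by
    gcongr
    exact mul_nonneg ha (Complex.normSq_nonneg p)
  have := mul_le_mul_of_nonneg_left hp d.cast_nonneg
  linarith

theorem re_inv_sub (t r : ℂ) : (t - r)⁻¹.re = (t.re - r.re) * Complex.normSq (t - r)⁻¹ := by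
  rw [Complex.inv_re, Complex.sub_re, Complex.normSq_inv, div_eq_mul_inv]

theorem re_mul_normSq_inv_sub_lt_re {t r : ℂ} (ht : 0 ≤ t.re) (hr : r.re < 0) :
    t.re * Complex.normSq (t - r)⁻¹ < (t - r)⁻¹.re := by
  have htr : t ≠ r := by
    rintro rfl
    exact hr.not_ge ht
  rw [re_inv_sub]
  exact mul_lt_mul_of_pos_right (by linarith)
    (Complex.normSq_pos.2 (inv_ne_zero (sub_ne_zero.2 htr)))

/-- The case needed of Laguerre's theorem on polar derivatives: at a zero `z` of the polar
derivative, the `1 / (z - r)` with `r` a root would average to `1 / (z - γ)`. -/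
theorem eval_binomialPolynomial_add_mul_shift_ne_zero {d : ℕ} {a : ℕ → ℂ}
    (ha : ∀ z : ℂ, 0 ≤ z.re → (binomialPolynomial (d + 1) a).eval z ≠ 0) {γ : ℂ} (hγ : 0 ≤ γ.re)
    {z : ℂ} (hz : 0 ≤ z.re) :
    (binomialPolynomial d fun j => a j + γ * a (j + 1)).eval z ≠ 0 := by
  have hpolar := eval_binomialPolynomial_add_mul_shift d a γ z
  have hdegree := natDegree_binomialPolynomial_le (d + 1) a
  set K := binomialPolynomial (d + 1) a
  intro h
  rw [h, mul_zero, (IsAlgClosed.splits K).eval_derivative_eq_eval_mul_sum (ha z hz)] at hpolar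
  simp only [one_div] at hpolar
  set m := K.roots.map fun r => (z - r)⁻¹ with hm
  have hd : ((d + 1 : ℕ) : ℂ) ≠ 0 := Nat.cast_ne_zero.2 d.succ_ne_zero
  have hsum : (z - γ) * m.sum = (d + 1 : ℕ) := by
    refine mul_left_cancel₀ (ha z hz) ?_
    push_cast
    linear_combination hpolar
  have hzγ : z - γ ≠ 0 := left_ne_zero_of_mul (hsum ▸ hd)
  have hm0 : m ≠ 0 := fun hm0 => right_ne_zero_of_mul (hsum ▸ hd) (by rw [hm0, Multiset.sum_zero])
  have hdisc : ∀ w ∈ m, z.re * Complex.normSq w < w.re := by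
    intro w hw
    obtain ⟨r, hr, rfl⟩ := Multiset.mem_map.1 hw
    exact re_mul_normSq_inv_sub_lt_re hz
      (not_le.1 fun hr0 => ha r hr0 (isRoot_of_mem_roots hr))
  have hpole : (z - γ)⁻¹.re ≤ z.re * Complex.normSq (z - γ)⁻¹ := by
    rw [re_inv_sub]
    exact mul_le_mul_of_nonneg_right (by linarith) (Complex.normSq_nonneg _)
  have hcard : m.card ≤ d + 1 := by
    rw [hm, Multiset.card_map]
    exact K.card_roots'.trans hdegree
  refine multiset_sum_ne_natCast_mul_of_mul_normSq_lt_re hz hm0 hdisc hcard hpole ?_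
  rw [← hsum]
  field_simp

theorem exists_eq_one_add_C_mul_X_mul {f : ℂ[X]} (hdeg : f.natDegree ≠ 0)
    (hf : ∀ t ∈ pointedHalfPlane, f.eval t ≠ 0) :
    ∃ (γ : ℂ) (g : ℂ[X]), 0 ≤ γ.re ∧ f.natDegree = g.natDegree + 1 ∧ f = (1 + C γ * X) * g := by
  obtain ⟨r, hr⟩ := IsAlgClosed.exists_root f fun h => hdeg (natDegree_eq_of_degree_eq_some h)
  have hr0 : r ≠ 0 := fun h => hf r (Or.inl h) hr
  have hrre : r.re ≤ 0 := not_lt.1 fun h => hf r (Or.inr h) hr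
  obtain ⟨g, rfl⟩ := dvd_iff_isRoot.2 hr
  have hg : g ≠ 0 := by
    rintro rfl
    exact hdeg (by rw [mul_zero, natDegree_zero])
  refine ⟨-r⁻¹, C (-r) * g, ?_, ?_, ?_⟩
  · rw [Complex.neg_re, Complex.inv_re, neg_nonneg]
    exact div_nonpos_of_nonpos_of_nonneg hrre (Complex.normSq_nonneg r)
  · rw [natDegree_mul (X_sub_C_ne_zero r) hg, natDegree_X_sub_C,
      natDegree_C_mul (neg_ne_zero.2 hr0), add_comm]
  · have hfactor : X - C r = (1 + C (-r⁻¹) * X) * C (-r) := by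
      have : C r⁻¹ * C r = (1 : ℂ[X]) := by rw [← C_mul, inv_mul_cancel₀ hr0, C_1]
      rw [C_neg, C_neg]
      linear_combination -X * this
    rw [hfactor, mul_assoc]

theorem umbralEval_C_ne_zero {d : ℕ} {a : ℕ → ℂ}
    (ha : ∀ z : ℂ, 0 ≤ z.re → (binomialPolynomial d a).eval z ≠ 0) {c : ℂ}
    (hc : ∀ t ∈ pointedHalfPlane, (C c).eval t ≠ 0) : umbralEval a (C c) ≠ 0 := by
  have ha0 : a 0 ≠ 0 := eval_zero_binomialPolynomial d a ▸ ha 0 le_rfl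
  have hc0 : c ≠ 0 := by simpa only [eval_C] using hc 0 (Set.mem_insert _ _)
  simpa only [pow_zero, mul_one] using
    (umbralEval_C_mul_X_pow a c 0).trans_ne (mul_ne_zero hc0 ha0)

/-- The Schur–Szegő composition theorem for the right half-plane: splitting off a linear factor of
`f` amounts to passing to a polar derivative of the binomial polynomial. -/
theorem umbralEval_ne_zero {d : ℕ} {a : ℕ → ℂ}
    (ha : ∀ z : ℂ, 0 ≤ z.re → (binomialPolynomial d a).eval z ≠ 0) {f : ℂ[X]}
    (hfd : f.natDegree ≤ d) (hf : ∀ t ∈ pointedHalfPlane, f.eval t ≠ 0) :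
    umbralEval a f ≠ 0 := by
  induction d generalizing a f with
  | zero =>
    obtain ⟨c, rfl⟩ := natDegree_eq_zero.1 (Nat.le_zero.1 hfd)
    exact umbralEval_C_ne_zero ha hf
  | succ d ih =>
    by_cases hdeg : f.natDegree = 0
    · obtain ⟨c, rfl⟩ := natDegree_eq_zero.1 hdeg
      exact umbralEval_C_ne_zero ha hf
    · obtain ⟨γ, g, hγ, hfg, rfl⟩ := exists_eq_one_add_C_mul_X_mul hdeg hf
      rw [umbralEval_one_add_C_mul_X_mul]
      refine ih (fun z hz => eval_binomialPolynomial_add_mul_shift_ne_zero ha hγ hz) (by omega) ?_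
      intro t ht
      have := hf t ht
      rw [eval_mul] at this
      exact right_ne_zero_of_mul this

theorem sum_mul_prod_ne_zero_of_binomialPolynomial {σ ι : Type*} [Fintype σ]
    (s : Finset ι) (c : ι → ℂ) {m : ι → σ → ℕ} {d : σ → ℕ}
    (hm : ∀ i ∈ s, ∀ v, m i v ≤ d v) {a : σ → ℕ → ℂ}
    (ha : ∀ v, ∀ z : ℂ, 0 ≤ z.re → (binomialPolynomial (d v) (a v)).eval z ≠ 0)
    (hs : ∀ t : σ → ℂ, (∀ v, t v ∈ pointedHalfPlane) → ∑ i ∈ s, c i * ∏ v, t v ^ m i v ≠ 0) :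
    ∑ i ∈ s, c i * ∏ v, a v (m i v) ≠ 0 := by
  classical
  suffices hpartial : ∀ (T : Finset σ) (t : σ → ℂ), (∀ v, t v ∈ pointedHalfPlane) →
      ∑ i ∈ s, c i * ∏ v, T.piecewise a (fun v j => t v ^ j) v (m i v) ≠ 0 by
    simpa only [Finset.piecewise_univ] using
      hpartial Finset.univ 0 fun _ => Set.mem_insert _ _
  intro T
  induction T using Finset.induction_on with
  | empty => simpa only [Finset.piecewise_empty] using hs
  | insert v T hv ih =>
    intro t ht
    set b := T.piecewise a fun v j => t v ^ j
    let f : ℂ[X] := ∑ i ∈ s, C (c i * ∏ w ∈ Finset.univ.erase v, b w (m i w)) * X ^ m i v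
    have hfd : f.natDegree ≤ d v := natDegree_sum_le_of_forall_le _ _ fun i hi =>
      (natDegree_C_mul_X_pow_le _ _).trans (hm i hi v)
    have humbral : ∀ q : ℕ → ℂ,
        umbralEval q f = ∑ i ∈ s, c i * ∏ w, Function.update b v q w (m i w) := by
      intro q
      rw [map_sum]
      refine Finset.sum_congr rfl fun i _ => ?_
      rw [umbralEval_C_mul_X_pow, ← Finset.mul_prod_erase _ _ (Finset.mem_univ v),
        Function.update_self, mul_assoc, mul_comm (q _)]
      congr 2
      refine Finset.prod_congr rfl fun w hw => ?_
      rw [Function.update_of_ne (Finset.ne_of_mem_erase hw)]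
    rw [Finset.piecewise_insert, ← humbral]
    refine umbralEval_ne_zero (ha v) hfd fun x hx => ?_
    have hpow : Function.update (fun w j => t w ^ j) v (fun j => x ^ j) =
        fun w j => Function.update t v x w ^ j :=
      funext fun w => (Function.apply_update (fun _ y (j : ℕ) => y ^ j) t v x w).symm
    have htx : ∀ w, Function.update t v x w ∈ pointedHalfPlane :=
      (Function.forall_update_iff t fun _ y => y ∈ pointedHalfPlane).2 ⟨hx, fun w _ => ht w⟩
    rw [← umbralEval_pow, humbral, Finset.update_piecewise_of_notMem _ _ _ hv, hpow]
    exact ih _ htx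

theorem one_add_mul_mul_ne_zero {l : ℝ} (hl : 0 ≤ l) {a b : ℂ} (ha : a ∈ pointedHalfPlane)
    (hb : b ∈ pointedHalfPlane) : 1 + l * (a * b) ≠ 0 := by
  rcases ha with rfl | ha
  · simp
  rcases hb with rfl | hb
  · simp
  intro h
  have hre : (star a * (1 + l * (a * b))).re = a.re + l * Complex.normSq a * b.re := by
    simp only [Complex.star_def, Complex.mul_re, Complex.mul_im, Complex.add_re, Complex.add_im,
      Complex.one_re, Complex.one_im, Complex.ofReal_re, Complex.ofReal_im, Complex.conj_re,
      Complex.conj_im, Complex.normSq_apply]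
    ring
  have hpos : 0 < a.re + l * Complex.normSq a * b.re :=
    add_pos_of_pos_of_nonneg ha (mul_nonneg (mul_nonneg hl (Complex.normSq_nonneg a)) (le_of_lt hb))
  rw [h, mul_zero, Complex.zero_re] at hre
  exact hpos.ne hre

variable {α β : Type*}

theorem degree_eq_sum (G : Graph α β) (H : Finset E(G)) (v : V(G)) :
    degree G H v = ∑ e ∈ H, degree G {e} v := by
  simp only [degree, Finset.card_filter, Finset.sum_singleton, Finset.sum_add_distrib]

theorem degree_mono (G : Graph α β) {H K : Finset E(G)} (h : H ⊆ K) (v : V(G)) :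
    degree G H v ≤ degree G K v := by
  rw [degree_eq_sum, degree_eq_sum G K]
  exact Finset.sum_le_sum_of_subset h

theorem exists_prod_pow_eq_mul {σ M : Type*} [Fintype σ] [CommMonoid M] {m : σ → ℕ}
    (hm : ∑ v, m v = 2) : ∃ a b, ∀ t : σ → M, ∏ v, t v ^ m v = t a * t b := by
  have hcard : (∑ v, m v • ({v} : Multiset σ)).card = 2 := by
    simpa [map_sum] using hm
  obtain ⟨a, b, hab⟩ := Multiset.card_eq_two.1 hcard
  refine ⟨a, b, fun t => ?_⟩
  have hmap := congrArg (fun s => (Multiset.mapAddMonoidHom t s).prod) hab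
  simpa [Multiset.prod_sum, Multiset.map_nsmul, Multiset.prod_nsmul] using hmap

section Partition

variable (G : Graph α β) [Fintype V(G)] [Fintype E(G)]

theorem sum_prod_mul_prod_pow_degree {R : Type*} [CommSemiring R] (lam : E(G) → R)
    (t : V(G) → R) :
    ∑ H : Finset E(G), (∏ e ∈ H, lam e) * ∏ v, t v ^ degree G H v =
      ∏ e, (1 + lam e * ∏ v, t v ^ degree G {e} v) := by
  rw [Finset.prod_one_add, Finset.powerset_univ]
  refine Finset.sum_congr rfl fun H _ => ?_
  rw [Finset.prod_mul_distrib, Finset.prod_comm]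
  simp only [Finset.prod_pow_eq_pow_sum, ← degree_eq_sum]

theorem sum_prod_mul_prod_pow_degree_ne_zero {lam : E(G) → ℝ} (hlam : ∀ e, 0 ≤ lam e)
    {t : V(G) → ℂ} (ht : ∀ v, t v ∈ pointedHalfPlane) :
    ∑ H : Finset E(G), (∏ e ∈ H, (lam e : ℂ)) * ∏ v, t v ^ degree G H v ≠ 0 := by
  rw [sum_prod_mul_prod_pow_degree]
  refine Finset.prod_ne_zero_iff.2 fun e _ => ?_
  obtain ⟨a, b, hab⟩ := exists_prod_pow_eq_mul (M := ℂ) (sum_degree G {e})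
  rw [hab]
  exact one_add_mul_mul_ne_zero (hlam e) (ht a) (ht b)

end Partition

theorem mul_mem_sector {θ : ℝ} {x w : ℂ} (hx : x ∈ sector θ) (hw : w ≠ 0) (hwre : 0 ≤ w.re) :
    x * w ∈ sector (θ + Real.pi / 2) := by
  have hxw := mul_ne_zero hx.1 hw
  have hle : |(x * w).arg| ≤ |w.arg| + |x.arg| := by
    have := InnerProductGeometry.angle_le_angle_add_angle (x * w) x 1
    rwa [Complex.angle_one_right hxw, Complex.angle_one_right hx.1,
      Complex.angle_eq_abs_arg hxw hx.1, mul_div_cancel_left₀ w hx.1] at this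
  have hwarg := Complex.abs_arg_le_pi_div_two_iff.2 hwre
  exact ⟨hxw, by linarith [hx.2]⟩

theorem exists_sq_eq_of_mem_sector {θ : ℝ} {y : ℂ} (hy : y ∈ sector (2 * θ)) :
    ∃ x ∈ sector θ, x ^ 2 = y := by
  have him : (Complex.log y / 2).im = y.arg / 2 := by
    rw [Complex.div_ofNat_im, Complex.log_im]
  have harg : (Complex.exp (Complex.log y / 2)).arg = y.arg / 2 := by
    rw [← Complex.log_im, Complex.log_exp, him] <;>
      linarith [Real.pi_pos, Complex.neg_pi_lt_arg y, Complex.arg_le_pi y]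
  refine ⟨Complex.exp (Complex.log y / 2), ⟨Complex.exp_ne_zero _, ?_⟩, ?_⟩
  · rw [harg, abs_div, abs_two]
    linarith [hy.2]
  · rw [← Complex.exp_nat_mul, Nat.cast_ofNat, mul_div_cancel₀ _ two_ne_zero, Complex.exp_log hy.1]

theorem eval_key_mul_ne_zero (G : Graph α β) [Fintype E(G)] {u : V(G) → ℕ → ℂ} {v : V(G)}
    {θ : ℝ} (hu : u v 0 ≠ 0) (hkey : ∀ z ∈ sector (θ + Real.pi / 2), (key G u v).eval z ≠ 0)
    {x w : ℂ} (hx : x ∈ sector θ) (hw : 0 ≤ w.re) : (key G u v).eval (x * w) ≠ 0 := by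
  rcases eq_or_ne w 0 with rfl | hw0
  · rw [mul_zero]
    exact (eval_zero_binomialPolynomial _ _).trans_ne hu
  · exact hkey _ (mul_mem_sector hx hw0 hw)

section Composition

variable (G : Graph α β) [Fintype V(G)] [Fintype E(G)]

theorem eval_Z (lam : E(G) → ℂ) (u : V(G) → ℕ → ℂ) (x : V(G) → ℂ) :
    MvPolynomial.eval x (Z G lam u) =
      ∑ H : Finset E(G), (∏ e ∈ H, lam e) * ∏ v, (u v (degree G H v) * x v ^ degree G H v) := by
  simp only [Z, weight, map_sum, map_mul, map_prod, map_pow, MvPolynomial.eval_C,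
    MvPolynomial.eval_X, Finset.prod_mul_distrib, mul_assoc]

theorem eval_Zuni_sq (lam : E(G) → ℂ) (u : V(G) → ℕ → ℂ) (x : ℂ) :
    (Zuni G lam u).eval (x ^ 2) = MvPolynomial.eval (fun _ => x) (Z G lam u) := by
  rw [← expand_eval, expand_two_Zuni, ← coe_aeval_eq_eval, ← MvPolynomial.coe_aeval_eq_eval]
  change ((aeval x).comp (MvPolynomial.aeval fun _ => X)) _ = MvPolynomial.aeval _ _
  rw [MvPolynomial.comp_aeval]
  simp only [aeval_X]

variable {G}

theorem eval_Z_ne_zero_of_key {lam : E(G) → ℝ} (hlam : ∀ e, 0 ≤ lam e) {u : V(G) → ℕ → ℂ}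
    (hu : ∀ v, u v 0 ≠ 0) {θ : ℝ}
    (hkey : ∀ v, ∀ z ∈ sector (θ + Real.pi / 2), (key G u v).eval z ≠ 0)
    {x : V(G) → ℂ} (hx : ∀ v, x v ∈ sector θ) :
    MvPolynomial.eval x (Z G (fun e => (lam e : ℂ)) u) ≠ 0 := by
  rw [eval_Z]
  refine sum_mul_prod_ne_zero_of_binomialPolynomial (a := fun v j => u v j * x v ^ j) _ _
    (fun H _ v => degree_mono G H.subset_univ v) (fun v z hz => ?_)
    fun t ht => sum_prod_mul_prod_pow_degree_ne_zero G hlam ht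
  rw [eval_binomialPolynomial_mul_pow]
  exact eval_key_mul_ne_zero G (hu v) (hkey v) (hx v) hz

theorem eval_Zuni_ne_zero_of_key {lam : E(G) → ℝ} (hlam : ∀ e, 0 ≤ lam e) {u : V(G) → ℕ → ℂ}
    (hu : ∀ v, u v 0 ≠ 0) {θ : ℝ}
    (hkey : ∀ v, ∀ z ∈ sector (θ + Real.pi / 2), (key G u v).eval z ≠ 0)
    {y : ℂ} (hy : y ∈ sector (2 * θ)) : (Zuni G (fun e => (lam e : ℂ)) u).eval y ≠ 0 := by
  obtain ⟨x, hx, rfl⟩ := exists_sq_eq_of_mem_sector hy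
  rw [eval_Zuni_sq]
  exact eval_Z_ne_zero_of_key hlam hu hkey fun _ => hx

end Composition

theorem binomialPolynomial_ruelleActivity (d : ℕ) (u : ℝ) :
    binomialPolynomial d (ruelleActivity u) =
      1 + C (d * u : ℂ) * X + C (d.choose 2 : ℂ) * X ^ 2 := by
  ext j
  rw [coeff_binomialPolynomial]
  rcases j with _ | _ | _ | j <;> simp [ruelleActivity, coeff_one, coeff_X, coeff_C]

theorem neg_norm_mul_sin_lt_re {θ : ℝ} (hθ : θ ≤ Real.pi / 2) {z : ℂ}
    (hz : z ∈ sector (θ + Real.pi / 2)) : -(‖z‖ * Real.sin θ) < z.re := by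
  rw [← mul_neg, ← Real.cos_add_pi_div_two, ← Complex.norm_mul_cos_arg z, ← Real.cos_abs z.arg]
  exact mul_lt_mul_of_pos_left
    (Real.cos_lt_cos_of_nonneg_of_le_pi (abs_nonneg _) (by linarith) hz.2) (norm_pos_iff.2 hz.1)

theorem re_mul_and_im_mul_eq_zero_of_quadratic_eq_zero {b c : ℝ} {z : ℂ}
    (h : 1 + b * z + c * z ^ 2 = 0) :
    z.re * (1 + c * ‖z‖ ^ 2) + b * ‖z‖ ^ 2 = 0 ∧ z.im * (c * ‖z‖ ^ 2 - 1) = 0 := by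
  have hnorm := Complex.sq_norm_sub_sq_re z
  have hconj : star z * (1 + b * z + c * z ^ 2) = 0 := by rw [h, mul_zero]
  constructor
  · have := congrArg Complex.re hconj
    simp only [Complex.star_def, pow_two, Complex.mul_re, Complex.mul_im, Complex.add_re,
      Complex.add_im, Complex.one_re, Complex.one_im, Complex.ofReal_re, Complex.ofReal_im,
      Complex.conj_re, Complex.conj_im, Complex.zero_re] at this
    linear_combination this + (c * z.re + b) * hnorm
  · have := congrArg Complex.im hconj
    simp only [Complex.star_def, pow_two, Complex.mul_re, Complex.mul_im, Complex.add_re,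
      Complex.add_im, Complex.one_re, Complex.one_im, Complex.ofReal_re, Complex.ofReal_im,
      Complex.conj_re, Complex.conj_im, Complex.zero_im] at this
    linear_combination this + c * z.im * hnorm

theorem one_add_mul_add_mul_sq_ne_zero {b c θ : ℝ} (hc : 0 ≤ c) (hθ₀ : 0 ≤ θ)
    (hθ : θ ≤ Real.pi / 2) (hb : 2 * √c * Real.sin θ ≤ b) {z : ℂ}
    (hz : z ∈ sector (θ + Real.pi / 2)) : 1 + b * z + c * z ^ 2 ≠ 0 := by
  intro h
  have hsin : 0 ≤ Real.sin θ := Real.sin_nonneg_of_nonneg_of_le_pi hθ₀ (by linarith [Real.pi_pos])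
  have hb₀ : 0 ≤ b := le_trans (by positivity) hb
  have hr : 0 < ‖z‖ := norm_pos_iff.2 hz.1
  have hzre := neg_norm_mul_sin_lt_re hθ hz
  obtain ⟨hre, him⟩ := re_mul_and_im_mul_eq_zero_of_quadratic_eq_zero h
  rcases mul_eq_zero.1 him with him0 | hnorm1
  · have hneg : -‖z‖ < z.re := by
      have := mul_le_mul_of_nonneg_left (Real.sin_le_one θ) hr.le
      linarith
    have hpos : z.re = ‖z‖ :=
      (eq_or_eq_neg_of_abs_eq (Complex.abs_re_eq_norm.2 him0)).resolve_right hneg.ne'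
    rw [hpos] at hre
    have : 0 < ‖z‖ * (1 + c * ‖z‖ ^ 2) + b * ‖z‖ ^ 2 := by positivity
    exact this.ne' hre
  · have hsqrt : √c * ‖z‖ = 1 := by
      rw [← Real.sqrt_sq hr.le, ← Real.sqrt_mul hc, sub_eq_zero.1 hnorm1, Real.sqrt_one]
    have hb' : 2 * ‖z‖ * Real.sin θ ≤ b * ‖z‖ ^ 2 := by
      have := mul_le_mul_of_nonneg_right hb (sq_nonneg ‖z‖)
      linear_combination this - 2 * ‖z‖ * Real.sin θ * hsqrt
    rw [sub_eq_zero.1 hnorm1] at hre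
    linarith

theorem two_mul_sqrt_choose_two (d : ℕ) : 2 * √(d.choose 2 : ℝ) = d * √(2 - 2 / (d : ℝ)) := by
  rcases eq_or_ne d 0 with rfl | hd
  · simp
  calc 2 * √(d.choose 2 : ℝ) = √(2 ^ 2 * d.choose 2) := by
        rw [Real.sqrt_mul (sq_nonneg 2), Real.sqrt_sq zero_le_two]
    _ = √((d : ℝ) ^ 2 * (2 - 2 / d)) := by
        rw [Nat.cast_choose_two]
        congr 1
        field_simp
    _ = d * √(2 - 2 / (d : ℝ)) := by
        rw [Real.sqrt_mul (sq_nonneg _), Real.sqrt_sq d.cast_nonneg]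

theorem sqrt_two_sub_mul_sin_pi_div_four_le_one {s : ℝ} (hs : 0 ≤ s) :
    √(2 - s) * Real.sin (Real.pi / 4) ≤ 1 := by
  have hsqrt : √(2 - s) ≤ √2 := Real.sqrt_le_sqrt (sub_le_self 2 hs)
  rw [Real.sin_pi_div_four]
  calc √(2 - s) * (√2 / 2) ≤ √2 * (√2 / 2) := by gcongr
    _ = 1 := by rw [mul_div_assoc', Real.mul_self_sqrt zero_le_two, div_self two_ne_zero]

theorem real_nonpos_of_notMem_sector_pi {y : ℂ} (hy : y ∉ sector Real.pi) :
    y.im = 0 ∧ y.re ≤ 0 := by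
  rcases eq_or_ne y 0 with rfl | hy0
  · simp
  have hpi : Real.pi ≤ |y.arg| := not_lt.1 fun h => hy ⟨hy0, h⟩
  have harg : y.arg = Real.pi := by
    rcases le_abs.1 hpi with h | h
    · exact (Complex.arg_le_pi y).antisymm h
    · linarith [Complex.neg_pi_lt_arg y]
  obtain ⟨hre, him⟩ := Complex.arg_eq_pi_iff.1 harg
  exact ⟨him, hre.le⟩

theorem eval_key_ruelleActivity_ne_zero (G : Graph α β) [Fintype V(G)] [Fintype E(G)] {u θ : ℝ}
    (hθ₀ : 0 ≤ θ) (hθ : θ ≤ Real.pi / 2)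
    (hu : 1 ≤ maxDegree G → √(2 - 2 / (maxDegree G : ℝ)) * Real.sin θ ≤ u) (v : V(G)) {z : ℂ}
    (hz : z ∈ sector (θ + Real.pi / 2)) :
    (key G (fun _ => ruelleActivity u) v).eval z ≠ 0 := by
  set d := degree G Finset.univ v
  have hd : d ≤ maxDegree G := Finset.le_sup (f := degree G Finset.univ) (Finset.mem_univ v)
  change (binomialPolynomial d (ruelleActivity u)).eval z ≠ 0
  have hsin : 0 ≤ Real.sin θ := Real.sin_nonneg_of_nonneg_of_le_pi hθ₀ (by linarith [Real.pi_pos])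
  have hb : 2 * √(d.choose 2 : ℝ) * Real.sin θ ≤ d * u := by
    rw [two_mul_sqrt_choose_two, mul_assoc]
    rcases Nat.eq_zero_or_pos d with hd0 | hd0
    · simp [hd0]
    · refine le_trans ?_ (mul_le_mul_of_nonneg_left (hu (hd0.trans_le hd)) d.cast_nonneg)
      gcongr
  have := one_add_mul_add_mul_sq_ne_zero (Nat.cast_nonneg _) hθ₀ hθ hb hz
  rw [binomialPolynomial_ruelleActivity]
  simpa using this

end SubgraphPoly

open SubgraphPoly in
theorem mainTheorem5_general {α β : Type*} (G : Graph α β) [Fintype V(G)] [Fintype E(G)]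
    {lam : E(G) → ℝ} (hlam : ∀ e, 0 ≤ lam e) {u θ : ℝ} (hθ₀ : 0 ≤ θ) (hθ : θ ≤ Real.pi / 2)
    (hu : 1 ≤ maxDegree G → √(2 - 2 / (maxDegree G : ℝ)) * Real.sin θ ≤ u) :
    (∀ v, ∀ z ∈ sector (θ + Real.pi / 2), (key G (fun _ => ruelleActivity u) v).eval z ≠ 0) ∧
      (∀ x : V(G) → ℂ, (∀ v, x v ∈ sector θ) →
        MvPolynomial.eval x (Z G (fun e => (lam e : ℂ)) fun _ => ruelleActivity u) ≠ 0) ∧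
      ∀ y ∈ sector (2 * θ),
        (Zuni G (fun e => (lam e : ℂ)) fun _ => ruelleActivity u).eval y ≠ 0 := by
  have hu₀ : ∀ _ : V(G), ruelleActivity u 0 ≠ 0 := fun _ => by simp [ruelleActivity]
  have hkey := fun v z hz => eval_key_ruelleActivity_ne_zero (z := z) G hθ₀ hθ hu v hz
  exact ⟨hkey, fun x hx => eval_Z_ne_zero_of_key hlam hu₀ hkey hx,
    fun y hy => eval_Zuni_ne_zero_of_key hlam hu₀ hkey hy⟩

theorem mainTheorem5 {α β : Type*} (G : Graph α β) [Fintype V(G)] [Fintype E(G)]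
    (lam : E(G) → ℝ) (hlam : ∀ e, 0 ≤ lam e) :
    ((∀ v, SubgraphPoly.Nonvanishing₁ (SubgraphPoly.sector (3 * Real.pi / 4))
        (SubgraphPoly.key G (fun _ => SubgraphPoly.ruelleActivity 1) v)) ∧
      SubgraphPoly.Nonvanishing (SubgraphPoly.sector (Real.pi / 4))
        (SubgraphPoly.Z G (fun e => (lam e : ℂ)) (fun _ => SubgraphPoly.ruelleActivity 1)) ∧
      SubgraphPoly.Nonvanishing₁ (SubgraphPoly.sector (Real.pi / 2))
        (SubgraphPoly.Zuni G (fun e => (lam e : ℂ)) (fun _ => SubgraphPoly.ruelleActivity 1))) ∧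
    ∀ u : ℝ,
      (1 ≤ SubgraphPoly.maxDegree G → √(2 - 2 / (SubgraphPoly.maxDegree G : ℝ)) ≤ u) →
      (∀ v, SubgraphPoly.Nonvanishing₁ (SubgraphPoly.sector Real.pi)
        (SubgraphPoly.key G (fun _ => SubgraphPoly.ruelleActivity u) v)) ∧
      SubgraphPoly.Nonvanishing (SubgraphPoly.sector (Real.pi / 2))
        (SubgraphPoly.Z G (fun e => (lam e : ℂ)) (fun _ => SubgraphPoly.ruelleActivity u)) ∧
      SubgraphPoly.Nonvanishing₁ (SubgraphPoly.sector Real.pi)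
        (SubgraphPoly.Zuni G (fun e => (lam e : ℂ)) (fun _ => SubgraphPoly.ruelleActivity u)) ∧
      ∀ y : ℂ,
        (SubgraphPoly.Zuni G (fun e => (lam e : ℂ))
          (fun _ => SubgraphPoly.ruelleActivity u)).eval y = 0 →
        y.im = 0 ∧ y.re ≤ 0 := by
  refine ⟨?_, fun u hu => ?_⟩
  · have hangle : Real.pi / 4 + Real.pi / 2 = 3 * Real.pi / 4 := by ring
    have hangle' : 2 * (Real.pi / 4) = Real.pi / 2 := by ring
    obtain ⟨hkey, hZ, hZuni⟩ := mainTheorem5_general G hlam (u := 1) (θ := Real.pi / 4)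
      (by positivity) (by linarith [Real.pi_pos]) fun _ =>
        SubgraphPoly.sqrt_two_sub_mul_sin_pi_div_four_le_one (by positivity)
    rw [hangle] at hkey
    rw [hangle'] at hZuni
    exact ⟨fun v => .inr (hkey v), .inr hZ, .inr hZuni⟩
  · obtain ⟨hkey, hZ, hZuni⟩ := mainTheorem5_general G hlam (θ := Real.pi / 2)
      (by positivity) le_rfl (by rwa [Real.sin_pi_div_two, mul_one])
    rw [add_halves] at hkey
    rw [mul_div_cancel₀ _ two_ne_zero] at hZuni
    exact ⟨fun v => .inr (hkey v), .inr hZ, .inr hZuni,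
      fun y hy => SubgraphPoly.real_nonpos_of_notMem_sector_pi fun hmem => hZuni y hmem hy⟩
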